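/- Let $d\ge 1$ and $\Omega=\{0,\dots,d\}^{\mathbb N}$ with its product $\sigma$-algebra, a probability measure $\mathbb P$ and coordinate maps $X_n(w)=w_n$. Put $\mathcal F_{-1}=\{\varnothing,\Omega\}$ and $\mathcal F_n=\sigma(X_0,\dots,X_n)$. Let $v_0(n),\dots,v_d(n)\in\mathbb R^d$ $(n\in\mathbb N)$ be deterministic and let $Y_n=v_{X_n}(n)$. Assume that $(Y_n)$ generates an obtuse random walk with independent steps, that is: the $X_n$ are independent, $p_n^i:=\mathbb P(X_n=i)>0$ for all $n,i$, and for all $n\ge 0$ and $i,j\in\{1,\dots,d\}$ $$\mathbb E[Y_n^i\mid\mathcal F_{n-1}]=0,\qquad \mathbb E[Y_n^iY_n^j\mid\mathcal F_{n-1}]=\delta^{ij}.$$ Put $c_i^j(k)=p_k^i\,v_i^j(k)$. For $w\in\Omega$ let $w_i^k$ be $w$ with its coordinate of index $k$ replaced by $i$. For $F:\Omega\to\mathbb R$ let $D_kF=(D_k^1F,\dots,D_k^dF)$ with $$D_k^jF(w)=\sum_{i=0}^d c_i^j(k)\,F(w_i^k),\qquad \|DF\|:=\|DF\|_{L^\infty(\Omega,\ell^1(\mathbb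 N))}=\operatorname*{ess\,sup}_{w}\sum_{k=0}^\infty |D_kF(w)|,$$ where $|\cdot|$ is the Euclidean norm of $\mathbb R^d$. Let $F:\Omega\to\mathbb R$ be a bounded random variable such that almost surely, for all $k\in\mathbb N$ and $i,i'\in\{0,\dots,d\}$, $$|F(w_i^k)-F(w_{i'}^k)|\le K,$$ and suppose that $|c_i^j(k)|\le C$ for all $k\in\mathbb N$, $i\in\{0,\dots,d\}$, $j\in\{1,\dots,d\}$, for some constants $K,C>0$, and that $\|DF\|<\infty$. Let $g(u)=(1+u)\ln(1+u)-u$ for $u\ge 0$. Then for every $x\ge 0$ $$\mathbb P(F-\mathbb E[F]\ge x)\le\exp\left(-\frac{dC\|DF\|}{K}\,g\left(\frac{x}{dC\|DF\|}\right)\right)\le\exp\left(-\frac{x}{2K}\ln\left(1+\frac{x}{dC\|DF\|}\right)\right),$$ where, if $\|DF\|=0$, both bounds are read as their limits as $\|DF\|\downarrow 0$, that is, as $0$ for $x>0$ (and $1$ for $x=0$). -/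

import Mathlib

open MeasureTheory ProbabilityTheory
open scoped ENNReal

noncomputable section

namespace ObtuseWalk

/-- The canonical sample space `{0, …, d}^ℕ`, with its product `σ`-algebra. The coordinate map
`X_n` is `fun ω => ω n`. -/
abbrev Path (d : ℕ) : Type := ℕ → Fin (d + 1)

/-- The `σ`-algebra `𝓕_{n-1} = σ(X_0, …, X_{n-1})` of the strict past of time `n`; it is trivial
for `n = 0`. -/
def past (d n : ℕ) : MeasurableSpace (Path d) :=
  ⨆ m : Fin n, MeasurableSpace.comap (fun ω : Path d => ω m) inferInstance

theorem past_le (d n : ℕ) : past d n ≤ (inferInstance : MeasurableSpace (Path d)) :=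
  iSup_le fun m => (measurable_pi_apply (m : ℕ)).comap_le

/-- The increment `Y_n(ω) = v_{X_n(ω)}(n)`. -/
def increment {d : ℕ} (v : ℕ → Fin (d + 1) → EuclideanSpace ℝ (Fin d)) (n : ℕ) (ω : Path d) :
    EuclideanSpace ℝ (Fin d) :=
  v n (ω n)

/-- Under `P`, the process `Y_n = v_{X_n}(n)` is a (canonical) obtuse random walk in `ℝ^d` with
independent steps: each of the `d + 1` values is taken with positive probability,
`𝔼[Y_n^i | 𝓕_{n-1}] = 0` and `𝔼[Y_n^i Y_n^j | 𝓕_{n-1}] = δ^{ij}`. The values `v_i(n)` and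
their probabilities may vary with `n`. -/
structure IsObtuseRandomWalk {d : ℕ} (P : Measure (Path d))
    (v : ℕ → Fin (d + 1) → EuclideanSpace ℝ (Fin d)) : Prop where
  indep : iIndepFun (fun (n : ℕ) (ω : Path d) => ω n) P
  pos : ∀ (n : ℕ) (i : Fin (d + 1)), 0 < P {ω | ω n = i}
  condExp_increment : ∀ (n : ℕ) (i : Fin d),
    P[fun ω => increment v n ω i | past d n] =ᵐ[P] fun _ => 0
  condExp_increment_mul : ∀ (n : ℕ) (i j : Fin d),
    P[fun ω => increment v n ω i * increment v n ω j | past d n] =ᵐ[P]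
      fun _ => if i = j then 1 else 0

/-- The vector `c_i(k) = p_k^i v_i(k)`, where `p_k^i = P(X_k = i)`. -/
def coeff {d : ℕ} (P : Measure (Path d)) (v : ℕ → Fin (d + 1) → EuclideanSpace ℝ (Fin d))
    (k : ℕ) (i : Fin (d + 1)) : EuclideanSpace ℝ (Fin d) :=
  P.real {ω | ω k = i} • v k i

/-- The gradient `D_k F(ω) = ∑_i F(ω_i^k) c_i(k)`, a vector of `ℝ^d`; here `ω_i^k` is `ω` with
its coordinate of index `k` replaced by `i`. -/
def gradient {d : ℕ} (P : Measure (Path d)) (v : ℕ → Fin (d + 1) → EuclideanSpace ℝ (Fin d))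
    (F : Path d → ℝ) (k : ℕ) (ω : Path d) : EuclideanSpace ℝ (Fin d) :=
  ∑ i : Fin (d + 1), F (Function.update ω k i) • coeff P v k i

/-- `‖DF‖` in `L^∞(Ω, ℓ¹(ℕ))`: the essential supremum of `∑_k ‖D_k F‖`, where `ℝ^d` has the
Euclidean norm. -/
def gradientNorm {d : ℕ} (P : Measure (Path d))
    (v : ℕ → Fin (d + 1) → EuclideanSpace ℝ (Fin d)) (F : Path d → ℝ) : ℝ≥0∞ :=
  essSup (fun ω => ∑' k : ℕ, ‖gradient P v F k ω‖ₑ) P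

/-- `g(u) = (1 + u) ln(1 + u) - u`. -/
def rate (u : ℝ) : ℝ := (1 + u) * Real.log (1 + u) - u

end ObtuseWalk

end

/-! The proof is a Herbst argument driven by a covariance identity. Centring and normalization say
that the functions 1, v^1, …, v^d are orthonormal for the law of a step. As there are d+1 of them on
d+1 points, they form a basis, and so the Gram matrix of the vectors c_i(k) is the covariance matrix
p_i δ_ij − p_i p_j of that law (`inner_smul_smul_eq_covKernel`).

On finitely many coordinates, let (X, X') be coupled so that independently each pair of letters
agrees with probability α and is otherwise drawn independently. The α-derivative of E[f(X) g(X')] is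
the sum over k of E⟨D_k f(X), D_k g(X')⟩. The endpoints α = 1 and α = 0 give E[fg] and E[f]E[g], so
the covariance is this sum for some intermediate α, and it is at most ‖Df‖ B E[g] when |D_k g| ≤ B g
(`cubeMean_mul_sub_le`).

For g = exp(s(f − E f)) one may take B = dC(e^{sK} − 1). With L(s) = E[g] this gives L' ≤
dC‖Df‖(e^{sK} − 1) L, which integrates to the bound on L in `cubeMean_exp_le`. The bound passes from
E[F | X_0, …, X_{n-1}] to F by martingale convergence, and Chernoff's inequality with the optimal s
finishes. -/

namespace ObtuseWalk

/-! ### Finite product spaces and the interpolating coupling -/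

section Cube

variable {ι A : Type*} [Fintype ι] [DecidableEq ι] [Fintype A] [DecidableEq A]

/-- The integral of `h` against the product of the (signed) weights `p k` on the cube `A ^ ι`. -/
def cubeMean (p : ι → A → ℝ) (h : (ι → A) → ℝ) : ℝ :=
  ∑ w, (∏ k, p k (w k)) * h w

-- Exchanging the letter w k with the freshly drawn letter a is an involution of the pairs (w, a).
-- Hence resampling coordinate k with weights q replaces the factor p k by q. The weights may be
-- signed, which is how `covKernel` enters later.
omit [DecidableEq A] in
theorem cubeMean_resample (p : ι → A → ℝ) (k : ι) (hp : ∑ a, p k a = 1) (q : A → ℝ)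
    (h : (ι → A) → ℝ) :
    cubeMean p (fun w => ∑ a, q a * h (Function.update w k a)) =
      ∑ w, (∏ l ∈ Finset.univ.erase k, p l (w l)) * q (w k) * h w := by
  have e1 : cubeMean p (fun w => ∑ a, q a * h (Function.update w k a)) =
      ∑ x : (ι → A) × A, (∏ l, p l (x.1 l)) * (q x.2 * h (Function.update x.1 k x.2)) := by
    simp only [cubeMean, Finset.mul_sum, Fintype.sum_prod_type]
  have e2 : ∑ w, (∏ l ∈ Finset.univ.erase k, p l (w l)) * q (w k) * h w =
      ∑ x : (ι → A) × A,
        p k x.2 * ((∏ l ∈ Finset.univ.erase k, p l (x.1 l)) * q (x.1 k) * h x.1) := by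
    rw [Fintype.sum_prod_type]
    refine Finset.sum_congr rfl fun w _ => ?_
    dsimp only
    rw [← Finset.sum_mul, hp, one_mul]
  rw [e1, e2]
  have hinv : Function.Involutive
      (fun x : (ι → A) × A => (Function.update x.1 k x.2, x.1 k)) := by
    rintro ⟨w, a⟩
    simp
  refine Fintype.sum_equiv hinv.toPerm _ _ ?_
  rintro ⟨w, a⟩
  have e3 : ∏ l ∈ Finset.univ.erase k, p l (Function.update w k a l) =
      ∏ l ∈ Finset.univ.erase k, p l (w l) :=
    Finset.prod_congr rfl fun l hl => by
      rw [Function.update_of_ne (Finset.ne_of_mem_erase hl)]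
  simp only [Function.Involutive.coe_toPerm, Function.update_self, e3]
  rw [← Finset.mul_prod_erase _ _ (Finset.mem_univ k)]
  ring

omit [DecidableEq A] in
theorem cubeMean_mono {p : ι → A → ℝ} (hp : ∀ k a, 0 ≤ p k a) {h h' : (ι → A) → ℝ}
    (hh : ∀ w, h w ≤ h' w) : cubeMean p h ≤ cubeMean p h' :=
  Finset.sum_le_sum fun w _ =>
    mul_le_mul_of_nonneg_left (hh w) (Finset.prod_nonneg fun k _ => hp k _)

omit [DecidableEq A] in
theorem cubeMean_const_mul (p : ι → A → ℝ) (c : ℝ) (h : (ι → A) → ℝ) :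
    cubeMean p (fun w => c * h w) = c * cubeMean p h := by
  simp only [cubeMean, Finset.mul_sum]
  exact Finset.sum_congr rfl fun w _ => by ring

omit [DecidableEq A] in
theorem sum_prod_weights (p : ι → A → ℝ) (hp : ∀ k, ∑ a, p k a = 1) :
    ∑ w : ι → A, ∏ k, p k (w k) = 1 := by
  have := Finset.prod_univ_sum (fun _ : ι => (Finset.univ : Finset A)) p
  simpa [hp] using this.symm

/-- The law of a pair of letters which agree with probability `α` and are otherwise drawn
independently. -/
def pairWeight (p : A → ℝ) (α : ℝ) (z : A × A) : ℝ :=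
  α * (if z.1 = z.2 then p z.1 else 0) + (1 - α) * (p z.1 * p z.2)

/-- The covariance kernel of the weights `p`. -/
def covKernel (p : A → ℝ) (z : A × A) : ℝ :=
  (if z.1 = z.2 then p z.1 else 0) - p z.1 * p z.2

omit [Fintype A] in
theorem pairWeight_nonneg {p : A → ℝ} (hp : ∀ a, 0 ≤ p a) {α : ℝ} (h0 : 0 ≤ α) (h1 : α ≤ 1)
    (z : A × A) : 0 ≤ pairWeight p α z := by
  have h2 : 0 ≤ 1 - α := by linarith
  have h3 := hp z.1
  have h4 := hp z.2
  unfold pairWeight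
  split_ifs <;> positivity

theorem sum_pairWeight_left {p : A → ℝ} (hp : ∑ a, p a = 1) (α : ℝ) (b : A) :
    ∑ a, pairWeight p α (a, b) = p b := by
  simp only [pairWeight, Finset.sum_add_distrib, ← Finset.mul_sum, ← Finset.sum_mul, hp,
    Finset.sum_ite_eq', Finset.mem_univ, if_true]
  ring

theorem sum_pairWeight {p : A → ℝ} (hp : ∑ a, p a = 1) (α : ℝ) :
    ∑ z, pairWeight p α z = 1 := by
  rw [Fintype.sum_prod_type_right]
  simp only [sum_pairWeight_left hp, hp]

omit [DecidableEq A] in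
theorem cubeMean_prod (m : ι → A × A → ℝ) (H : (ι → A) → (ι → A) → ℝ) :
    cubeMean m (fun z => H (fun k => (z k).1) fun k => (z k).2) =
      ∑ w', ∑ w, (∏ k, m k (w k, w' k)) * H w w' := by
  rw [← Fintype.sum_prod_type_right
    (f := fun x : (ι → A) × (ι → A) => (∏ k, m k (x.1 k, x.2 k)) * H x.1 x.2)]
  exact Fintype.sum_equiv (Equiv.arrowProdEquivProdArrow ι (fun _ => A) (fun _ => A)) _ _
    fun z => rfl

theorem cubeMean_pairWeight_snd {p : ι → A → ℝ} (hp : ∀ k, ∑ a, p k a = 1) (α : ℝ)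
    (g : (ι → A) → ℝ) :
    cubeMean (fun k => pairWeight (p k) α) (fun z => g fun k => (z k).2) = cubeMean p g := by
  rw [cubeMean_prod (fun k => pairWeight (p k) α) (fun _ w' => g w')]
  refine Finset.sum_congr rfl fun w' _ => ?_
  rw [← Finset.sum_mul]
  congr 1
  have := Finset.prod_univ_sum (fun _ : ι => (Finset.univ : Finset A))
    (fun k a => pairWeight (p k) α (a, w' k))
  simpa [sum_pairWeight_left (hp _)] using this.symm

theorem cubeMean_pairWeight_one (p : ι → A → ℝ) (f g : (ι → A) → ℝ) :
    cubeMean (fun k => pairWeight (p k) 1)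
      (fun z => f (fun k => (z k).1) * g fun k => (z k).2) =
      cubeMean p (fun w => f w * g w) := by
  rw [cubeMean_prod (fun k => pairWeight (p k) 1) (fun w w' => f w * g w')]
  refine Finset.sum_congr rfl fun w' _ => ?_
  rw [Finset.sum_eq_single w']
  · simp [pairWeight]
  · intro w _ hw
    obtain ⟨k, hk⟩ := Function.ne_iff.1 hw
    rw [Finset.prod_eq_zero (Finset.mem_univ k), zero_mul]
    simp [pairWeight, hk]
  · simp

theorem cubeMean_pairWeight_zero (p : ι → A → ℝ) (f g : (ι → A) → ℝ) :
    cubeMean (fun k => pairWeight (p k) 0)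
      (fun z => f (fun k => (z k).1) * g fun k => (z k).2) =
      cubeMean p f * cubeMean p g := by
  rw [cubeMean_prod (fun k => pairWeight (p k) 0) (fun w w' => f w * g w'), cubeMean, cubeMean,
    Finset.sum_mul_sum, Finset.sum_comm]
  refine Finset.sum_congr rfl fun w _ => Finset.sum_congr rfl fun w' _ => ?_
  simp only [pairWeight, zero_mul, zero_add, sub_zero, one_mul, Finset.prod_mul_distrib]
  ring

/-- Each factor `pairWeight (p k) α` is affine in α with slope `covKernel (p k)`. The product rule
replaces one factor at a time by that slope, which amounts to resampling the pair at k with the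
signed weights `covKernel (p k)`. -/
theorem hasDerivAt_cubeMean_pairWeight {p : ι → A → ℝ} (hp : ∀ k, ∑ a, p k a = 1)
    (f g : (ι → A) → ℝ) (α : ℝ) :
    HasDerivAt (fun α => cubeMean (fun k => pairWeight (p k) α)
        (fun z => f (fun k => (z k).1) * g fun k => (z k).2))
      (∑ k, cubeMean (fun k => pairWeight (p k) α) (fun z => ∑ c, covKernel (p k) c *
        (f (Function.update (fun l => (z l).1) k c.1) *
          g (Function.update (fun l => (z l).2) k c.2)))) α := by
  have h1 : ∀ k, cubeMean (fun k => pairWeight (p k) α) (fun z => ∑ c, covKernel (p k) c *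
        (f (Function.update (fun l => (z l).1) k c.1) *
          g (Function.update (fun l => (z l).2) k c.2))) =
      ∑ z : ι → A × A, (∏ l ∈ Finset.univ.erase k, pairWeight (p l) α (z l)) *
        covKernel (p k) (z k) * (f (fun k => (z k).1) * g fun k => (z k).2) := by
    intro k
    rw [← cubeMean_resample (fun k => pairWeight (p k) α) k (sum_pairWeight (hp k) α)
      (covKernel (p k)) (fun z => f (fun k => (z k).1) * g fun k => (z k).2)]
    congr 1
    funext z
    refine Finset.sum_congr rfl fun c _ => ?_
    congr 3 <;> (funext l; by_cases hl : l = k)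
    all_goals first | (subst hl; simp) | simp [hl]
  rw [Finset.sum_congr rfl fun k _ => h1 k, Finset.sum_comm]
  unfold cubeMean
  refine HasDerivAt.fun_sum fun z _ => ?_
  rw [← Finset.sum_mul]
  refine HasDerivAt.mul_const ?_ _
  have h2 : ∀ k ∈ (Finset.univ : Finset ι),
      HasDerivAt (fun α => pairWeight (p k) α (z k)) (covKernel (p k) (z k)) α := by
    intro k _
    have h3 := ((hasDerivAt_id α).mul_const (if (z k).1 = (z k).2 then p k (z k).1 else 0)).add
      (((hasDerivAt_const α (1 : ℝ)).sub (hasDerivAt_id α)).mul_const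
        (p k (z k).1 * p k (z k).2))
    refine h3.congr_deriv ?_
    simp only [covKernel]
    ring
  simpa only [smul_eq_mul] using HasDerivAt.fun_finsetProd h2

end Cube

/-! ### Vectors whose Gram matrix is a covariance kernel -/

section Frame

variable {A E : Type*} [Fintype A] [DecidableEq A] [NormedAddCommGroup E] [InnerProductSpace ℝ E]

theorem inner_sum_smul_sum_smul {p : A → ℝ} {c : A → E}
    (hc : ∀ a b, inner ℝ (c a) (c b) = covKernel p (a, b)) (f g : A → ℝ) :
    inner ℝ (∑ a, f a • c a) (∑ b, g b • c b) = ∑ z : A × A, covKernel p z * (f z.1 * g z.2) := by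
  rw [Fintype.sum_prod_type, sum_inner]
  refine Finset.sum_congr rfl fun a _ => ?_
  rw [inner_sum]
  refine Finset.sum_congr rfl fun b _ => ?_
  rw [real_inner_smul_left, real_inner_smul_right, hc]
  ring

/-- The left side is the variance of g under p, that is, half the sum of p a p b (g a − g b)². Only
b ≠ a contributes, and the sum of p a p b over b ≠ a is p a − (p a)² = ‖c a‖². -/
theorem norm_sq_sum_smul_le {p : A → ℝ} (hp0 : ∀ a, 0 ≤ p a) (hp : ∑ a, p a = 1) {c : A → E}
    (hc : ∀ a b, inner ℝ (c a) (c b) = covKernel p (a, b)) (g : A → ℝ) {B : ℝ}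
    (hg : ∀ a b, |g a - g b| ≤ B) :
    ‖∑ a, g a • c a‖ ^ 2 ≤ B ^ 2 / 2 * ∑ a, ‖c a‖ ^ 2 := by
  have e1 : ‖∑ a, g a • c a‖ ^ 2 = (∑ a, ∑ b, p a * p b * (g a - g b) ^ 2) / 2 := by
    rw [← real_inner_self_eq_norm_sq, inner_sum_smul_sum_smul hc, Fintype.sum_prod_type]
    have r1 : ∀ a, ∑ b, covKernel p (a, b) * (g a * g b) =
        p a * g a ^ 2 - (p a * g a) * ∑ b, p b * g b := by
      intro a
      simp only [covKernel, sub_mul, ite_mul, zero_mul, Finset.sum_sub_distrib,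
        Finset.sum_ite_eq, Finset.mem_univ, if_true, Finset.mul_sum]
      congr 1
      · ring
      · exact Finset.sum_congr rfl fun b _ => by ring
    have r2 : ∀ a, ∑ b, p a * p b * (g a - g b) ^ 2 =
        p a * g a ^ 2 * ∑ b, p b - 2 * ((p a * g a) * ∑ b, p b * g b) +
          p a * ∑ b, p b * g b ^ 2 := by
      intro a
      simp only [Finset.mul_sum, ← Finset.sum_sub_distrib, ← Finset.sum_add_distrib]
      exact Finset.sum_congr rfl fun b _ => by ring
    simp only [r1, r2, hp, Finset.sum_sub_distrib, Finset.sum_add_distrib, ← Finset.sum_mul,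
      ← Finset.mul_sum, mul_one, one_mul]
    ring
  have e2 : ∀ a, ‖c a‖ ^ 2 = ∑ b, p a * p b - p a * p a := by
    intro a
    rw [← real_inner_self_eq_norm_sq, hc, ← Finset.mul_sum, hp]
    simp [covKernel]
  have e3 : ∀ a, ∑ b, p a * p b * (g a - g b) ^ 2 ≤ B ^ 2 * ‖c a‖ ^ 2 := by
    intro a
    have e4 : ∑ b, p a * p b * (g a - g b) ^ 2 ≤
        ∑ b, B ^ 2 * (p a * p b - if a = b then p a * p a else 0) := by
      refine Finset.sum_le_sum fun b _ => ?_
      by_cases hab : a = b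
      · subst hab; simp
      · rw [if_neg hab, sub_zero, mul_comm (B ^ 2)]
        refine mul_le_mul_of_nonneg_left ?_ (mul_nonneg (hp0 a) (hp0 b))
        exact sq_le_sq' (abs_le.1 (hg a b)).1 (abs_le.1 (hg a b)).2
    refine e4.trans (le_of_eq ?_)
    rw [e2, ← Finset.mul_sum, Finset.sum_sub_distrib]
    simp
  rw [e1, Finset.mul_sum]
  have := Finset.sum_le_sum fun a (_ : a ∈ Finset.univ) => e3 a
  rw [← Finset.mul_sum] at this ⊢
  linarith

end Frame

/-! ### Covariance inequality and exponential moments on a finite product -/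

section CubeFrame

variable {ι A E : Type*} [Fintype ι] [DecidableEq ι] [Fintype A] [DecidableEq A]
  [NormedAddCommGroup E] [InnerProductSpace ℝ E]

/-- A covariance estimate on a product of finite probability spaces: interpolating between the
diagonal and the product coupling, some coupling computes the covariance of `f` and `g` as the
mean of the inner products of their discrete gradients. -/
theorem cubeMean_mul_sub_le {p : ι → A → ℝ} (hp0 : ∀ k a, 0 ≤ p k a)
    (hp : ∀ k, ∑ a, p k a = 1) {c : ι → A → E}
    (hc : ∀ k a b, inner ℝ (c k a) (c k b) = covKernel (p k) (a, b))
    (f g : (ι → A) → ℝ) (hg0 : ∀ w, 0 ≤ g w) {N B : ℝ} (hB : 0 ≤ B)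
    (hf : ∀ w, ∑ k, ‖∑ a, f (Function.update w k a) • c k a‖ ≤ N)
    (hg : ∀ w k, ‖∑ a, g (Function.update w k a) • c k a‖ ≤ B * g w) :
    cubeMean p (fun w => f w * g w) - cubeMean p f * cubeMean p g ≤ N * B * cubeMean p g := by
  have hd := hasDerivAt_cubeMean_pairWeight hp f g
  -- The mean value theorem replaces integration over α: one intermediate coupling suffices, because
  -- its second marginal is p for every α and the final bound involves only E[g].
  obtain ⟨α, hα, h⟩ := exists_hasDerivAt_eq_slope _ _ zero_lt_one
    (fun x _ => (hd x).continuousAt.continuousWithinAt) (fun x _ => hd x)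
  rw [sub_zero, div_one, cubeMean_pairWeight_one, cubeMean_pairWeight_zero] at h
  rw [← h, ← cubeMean_pairWeight_snd hp α g, ← cubeMean_const_mul]
  have hinner : ∀ (k : ι) (z : ι → A × A), ∑ e, covKernel (p k) e *
      (f (Function.update (fun l => (z l).1) k e.1) *
        g (Function.update (fun l => (z l).2) k e.2)) =
      inner ℝ (∑ a, f (Function.update (fun l => (z l).1) k a) • c k a)
        (∑ a, g (Function.update (fun l => (z l).2) k a) • c k a) := fun k z =>
    (inner_sum_smul_sum_smul (hc k) (fun a => f (Function.update (fun l => (z l).1) k a))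
      (fun a => g (Function.update (fun l => (z l).2) k a))).symm
  simp only [hinner]
  have hsum : ∀ H : ι → (ι → A × A) → ℝ, ∑ k, cubeMean (fun k => pairWeight (p k) α) (H k) =
      cubeMean (fun k => pairWeight (p k) α) (fun z => ∑ k, H k z) := by
    intro H
    simp only [cubeMean, Finset.mul_sum]
    exact Finset.sum_comm
  rw [hsum]
  refine cubeMean_mono (fun k => pairWeight_nonneg (hp0 k) hα.1.le hα.2.le) fun z => ?_
  -- Cauchy–Schwarz for each k, with the sup norm in k on the gradient of g and the ℓ¹ norm on that
  -- of f.
  calc _ ≤ ∑ k, ‖∑ a, f (Function.update (fun l => (z l).1) k a) • c k a‖ *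
        (B * g (fun l => (z l).2)) :=
        Finset.sum_le_sum fun k _ => (real_inner_le_norm _ _).trans
          (mul_le_mul_of_nonneg_left (hg _ k) (norm_nonneg _))
    _ ≤ N * (B * g (fun l => (z l).2)) := by
        rw [← Finset.sum_mul]
        exact mul_le_mul_of_nonneg_right (hf _) (mul_nonneg hB (hg0 _))
    _ = _ := by ring

/-- The exponential moment of a function on a finite product space whose discrete gradients are
summable with bound `N` and whose oscillation in each coordinate is at most `K`. The constant `D`
controls the size of the frames. -/
theorem cubeMean_exp_le {p : ι → A → ℝ} (hp0 : ∀ k a, 0 ≤ p k a)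
    (hp : ∀ k, ∑ a, p k a = 1) {c : ι → A → E}
    (hc : ∀ k a b, inner ℝ (c k a) (c k b) = covKernel (p k) (a, b))
    {D : ℝ} (hD : 0 ≤ D) (hcD : ∀ k, ∑ a, ‖c k a‖ ^ 2 ≤ 2 * D ^ 2)
    (f : (ι → A) → ℝ) {N K : ℝ} (hK : 0 < K)
    (hf : ∀ w, ∑ k, ‖∑ a, f (Function.update w k a) • c k a‖ ≤ N)
    (hfK : ∀ w k a b, |f (Function.update w k a) - f (Function.update w k b)| ≤ K)
    {s : ℝ} (hs : 0 ≤ s) :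
    cubeMean p (fun w => Real.exp (s * (f w - cubeMean p f))) ≤
      Real.exp (D * N * ((Real.exp (s * K) - 1) / K - s)) := by
  set m := cubeMean p f with hm
  have hcov : ∀ s, 0 ≤ s → cubeMean p (fun w => (f w - m) * Real.exp (s * (f w - m))) ≤
      D * N * (Real.exp (s * K) - 1) * cubeMean p (fun w => Real.exp (s * (f w - m))) := by
    intro s hs
    have hR : 0 ≤ Real.exp (s * K) - 1 := by
      have := Real.one_le_exp (mul_nonneg hs hK.le)
      linarith
    have hB : 0 ≤ D * (Real.exp (s * K) - 1) := mul_nonneg hD hR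
    have key := cubeMean_mul_sub_le hp0 hp hc f (fun w => Real.exp (s * (f w - m)))
      (fun w => (Real.exp_pos _).le) hB hf (fun w k => by
        have hosc : ∀ a b, |Real.exp (s * (f (Function.update w k a) - m)) -
            Real.exp (s * (f (Function.update w k b) - m))| ≤
              (Real.exp (s * K) - 1) * Real.exp (s * (f w - m)) := by
          -- Comparison with the minimizing letter: all values lie between the minimum and e^{sK}
          -- times it, and the minimum is at most the value at w, since w is itself one of its own
          -- updates at k.
          obtain ⟨b₀, -, hb₀⟩ := Finset.exists_min_image Finset.univ
            (fun a => f (Function.update w k a)) ⟨w k, Finset.mem_univ _⟩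
          have hlow : ∀ a, Real.exp (s * (f (Function.update w k b₀) - m)) ≤
              Real.exp (s * (f (Function.update w k a) - m)) := fun a =>
            Real.exp_le_exp.2 (mul_le_mul_of_nonneg_left
              (sub_le_sub_right (hb₀ a (Finset.mem_univ a)) _) hs)
          have hup : ∀ a, Real.exp (s * (f (Function.update w k a) - m)) ≤
              Real.exp (s * K) * Real.exp (s * (f (Function.update w k b₀) - m)) := by
            intro a
            rw [← Real.exp_add, ← mul_add]
            refine Real.exp_le_exp.2 (mul_le_mul_of_nonneg_left ?_ hs)
            have := (abs_le.1 (hfK w k a b₀)).2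
            linarith
          have hw := hlow (w k)
          rw [Function.update_eq_self] at hw
          have hw' := mul_le_mul_of_nonneg_left hw hR
          intro a b
          rw [abs_le]
          constructor <;> linarith [hlow a, hlow b, hup a, hup b]
        -- The factor 1/2 in this variance bound cancels the 2 in `hcD`.
        have h1 := norm_sq_sum_smul_le (hp0 k) (hp k) (hc k)
          (fun a => Real.exp (s * (f (Function.update w k a) - m))) hosc
        refine le_of_sq_le_sq (h1.trans ?_) (mul_nonneg hB (Real.exp_pos _).le)
        refine (mul_le_mul_of_nonneg_left (hcD k) (by positivity)).trans (le_of_eq ?_)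
        ring)
    have e1 : cubeMean p (fun w => (f w - m) * Real.exp (s * (f w - m))) =
        cubeMean p (fun w => f w * Real.exp (s * (f w - m))) -
          m * cubeMean p (fun w => Real.exp (s * (f w - m))) := by
      rw [← cubeMean_const_mul]
      simp only [cubeMean, ← Finset.sum_sub_distrib]
      exact Finset.sum_congr rfl fun w _ => by ring
    rw [e1]
    refine key.trans (le_of_eq ?_)
    ring
  -- The integrating factor of the differential inequality `hcov`; its exponent is minus the
  -- integral of D N (e^{tK} − 1) over t from 0 to s. Thus φ decreases from φ 0 = 1.
  set φ : ℝ → ℝ := fun s => cubeMean p (fun w => Real.exp (s * (f w - m))) *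
    Real.exp (-(D * N * ((Real.exp (s * K) - 1) / K - s))) with hφ
  have hder : ∀ s, HasDerivAt φ
      ((cubeMean p (fun w => (f w - m) * Real.exp (s * (f w - m))) -
        D * N * (Real.exp (s * K) - 1) * cubeMean p (fun w => Real.exp (s * (f w - m)))) *
        Real.exp (-(D * N * ((Real.exp (s * K) - 1) / K - s)))) s := by
    intro s
    have h1 : HasDerivAt (fun s => cubeMean p (fun w => Real.exp (s * (f w - m))))
        (cubeMean p (fun w => (f w - m) * Real.exp (s * (f w - m)))) s := by
      unfold cubeMean
      refine HasDerivAt.fun_sum fun w _ => HasDerivAt.const_mul _ ?_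
      refine ((hasDerivAt_id s).mul_const (f w - m)).exp.congr_deriv ?_
      simp [mul_comm]
    have h2 : HasDerivAt (fun s => Real.exp (-(D * N * ((Real.exp (s * K) - 1) / K - s))))
        (Real.exp (-(D * N * ((Real.exp (s * K) - 1) / K - s))) *
          -(D * N * (Real.exp (s * K) * K / K - 1))) s := by
      have h3 : HasDerivAt (fun s => Real.exp (s * K)) (Real.exp (s * K) * K) s := by
        simpa using ((hasDerivAt_id s).mul_const K).exp
      exact ((((h3.sub_const 1).div_const K).sub (hasDerivAt_id s)).const_mul (D * N)).neg.exp
    refine (h1.mul h2).congr_deriv ?_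
    rw [mul_div_cancel_right₀ _ hK.ne']
    ring
  have hanti : AntitoneOn φ (Set.Ici 0) := by
    refine antitoneOn_of_deriv_nonpos (convex_Ici 0)
      (fun x _ => (hder x).continuousAt.continuousWithinAt)
      (fun x _ => (hder x).differentiableAt.differentiableWithinAt) fun x hx => ?_
    rw [interior_Ici] at hx
    rw [(hder x).deriv]
    exact mul_nonpos_of_nonpos_of_nonneg (sub_nonpos.2 (hcov x (le_of_lt hx)))
      (Real.exp_pos _).le
  have h0 : φ 0 = 1 := by
    simp [hφ, cubeMean, sum_prod_weights p hp]
  have h1 := hanti (Set.mem_Ici.2 le_rfl) (Set.mem_Ici.2 hs) hs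
  rw [h0, hφ] at h1
  simp only [Real.exp_neg] at h1
  rwa [← div_eq_mul_inv, div_le_one (Real.exp_pos _)] at h1

end CubeFrame

/-! ### Obtuse systems -/

section Obtuse

/-- The vectors `p i • v i` of a centred, normalized system of `d + 1` vectors of `ℝ^d` have the
covariance kernel of `p` as their Gram matrix. -/
theorem inner_smul_smul_eq_covKernel {d : ℕ} {p : Fin (d + 1) → ℝ} (hp : ∑ i, p i = 1)
    {v : Fin (d + 1) → EuclideanSpace ℝ (Fin d)} (hv : ∀ j, ∑ i, p i * v i j = 0)
    (hvv : ∀ j j', ∑ i, p i * (v i j * v i j') = if j = j' then 1 else 0) (a b : Fin (d + 1)) :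
    inner ℝ (p a • v a) (p b • v b) = covKernel p (a, b) := by
  -- Adjoining the constant coordinate 1 makes the system square, so the orthonormality relation
  -- M₁M₂ = 1 can be reversed; M₂M₁ = 1 reads p a (1 + ⟨v a, v b⟩) = δ_ab.
  let W : Fin (d + 1) → Fin (d + 1) → ℝ := fun i => Fin.cons 1 (fun j => v i j)
  let M₁ : Matrix (Fin (d + 1)) (Fin (d + 1)) ℝ := Matrix.of fun j i => W i j
  let M₂ : Matrix (Fin (d + 1)) (Fin (d + 1)) ℝ := Matrix.of fun i j => p i * W i j
  have h1 : M₁ * M₂ = 1 := by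
    ext j j'
    simp only [Matrix.mul_apply, M₁, M₂, Matrix.of_apply, Matrix.one_apply]
    refine Fin.cases ?_ (fun j => ?_) j <;> refine Fin.cases ?_ (fun j' => ?_) j'
    · simp [W, hp]
    · simpa [W, (Fin.succ_ne_zero j').symm] using hv j'
    · simpa [W, mul_comm] using hv j
    · simp only [W, Fin.cons_succ, Fin.succ_inj]
      rw [← hvv]
      exact Finset.sum_congr rfl fun i _ => by ring
  have h2 : M₂ * M₁ = 1 := mul_eq_one_comm.1 h1
  have h3 := congrFun (congrFun h2 a) b
  simp only [Matrix.mul_apply, M₁, M₂, Matrix.of_apply, Matrix.one_apply, Fin.sum_univ_succ,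
    W, Fin.cons_zero, Fin.cons_succ, mul_one] at h3
  rw [real_inner_smul_left, real_inner_smul_right, PiLp.inner_apply]
  simp only [covKernel, RCLike.inner_apply, conj_trivial]
  have h4 : p a * ∑ j, v b j * v a j = (if a = b then 1 else 0) - p a := by
    rw [← h3, Finset.mul_sum, add_sub_cancel_left]
    exact Finset.sum_congr rfl fun i _ => by ring
  rw [mul_left_comm, h4]
  by_cases hab : a = b
  · subst hab; simp; ring
  · simp [hab]; ring

end Obtuse

/-! ### Conditioning on the first n coordinates -/

section Glue

variable {d n : ℕ}

/-- The first `n` coordinates of a path. -/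
def initial (d n : ℕ) (ω : Path d) : Fin n → Fin (d + 1) := fun k => ω k

/-- The path `ω` with its first `n` coordinates replaced by `z`. -/
def glue (z : Fin n → Fin (d + 1)) (ω : Path d) : Path d :=
  fun k => if h : k < n then z ⟨k, h⟩ else ω k

theorem glue_initial (ω : Path d) : glue (initial d n ω) ω = ω := by
  funext k
  simp [initial, glue]

theorem glue_update (z : Fin n → Fin (d + 1)) (k : Fin n) (i : Fin (d + 1)) (ω : Path d) :
    glue (Function.update z k i) ω = Function.update (glue z ω) k i := by
  funext l
  by_cases hl : l < n
  · by_cases hk : l = k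
    · subst hk
      simp [glue]
    · have : (⟨l, hl⟩ : Fin n) ≠ k := fun h => hk (by rw [← h])
      simp [glue, hl, Function.update_of_ne hk, Function.update_of_ne this]
  · have : l ≠ k := fun h => hl (h ▸ k.2)
    simp [glue, hl, Function.update_of_ne this]

theorem measurable_initial (d n : ℕ) : Measurable (initial d n) :=
  measurable_pi_lambda _ fun k => measurable_pi_apply (k : ℕ)

theorem measurable_glue (z : Fin n → Fin (d + 1)) : Measurable (glue z) := by
  refine measurable_pi_lambda _ fun k => ?_
  unfold glue
  split_ifs
  · exact measurable_const
  · exact measurable_pi_apply k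

theorem past_eq_comap_initial (d n : ℕ) :
    past d n = MeasurableSpace.comap (initial d n) inferInstance := by
  have : (inferInstance : MeasurableSpace (Fin n → Fin (d + 1))) =
      ⨆ k : Fin n, MeasurableSpace.comap (fun z => z k) inferInstance := rfl
  rw [this, MeasurableSpace.comap_iSup]
  simp only [MeasurableSpace.comap_comp]
  rfl

variable {P : Measure (Path d)}

/-- On the event that the path starts with z, gluing z changes nothing; and `glue z` depends only on
the coordinates of index at least n, which are independent of the start. -/
theorem measure_inter_preimage_glue (hP : iIndepFun (fun (n : ℕ) (ω : Path d) => ω n) P)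
    (z : Fin n → Fin (d + 1)) {T : Set (Path d)} (hT : MeasurableSet T) :
    P (initial d n ⁻¹' {z} ∩ T) = P (initial d n ⁻¹' {z}) * P (glue z ⁻¹' T) := by
  have e : initial d n ⁻¹' {z} ∩ T = initial d n ⁻¹' {z} ∩ glue z ⁻¹' T := by
    ext ω
    simp only [Set.mem_inter_iff, Set.mem_preimage, Set.mem_singleton_iff]
    refine and_congr_right fun h => ?_
    rw [← h, glue_initial]
  have hind := indep_iSup_of_disjoint
    (m := fun k : ℕ => MeasurableSpace.comap (fun ω : Path d => ω k) inferInstance)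
    (fun k => (measurable_pi_apply k).comap_le) ((iIndepFun_iff_iIndep _ _ _).1 hP)
    (S := {k | k < n}) (T := {k | ¬ k < n})
    (Set.disjoint_left.2 fun k h h' => h' h)
  rw [e]
  refine (Indep_iff _ _ _).1 hind _ _ ?_ ?_
  · have : past d n ≤ ⨆ k ∈ {k | k < n},
        MeasurableSpace.comap (fun ω : Path d => ω k) inferInstance :=
      iSup_le fun k => le_iSup₂ (f := fun (k : ℕ) (_ : k ∈ {k | k < n}) =>
        MeasurableSpace.comap (fun ω : Path d => ω k) inferInstance) (k : ℕ) k.2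
    refine this _ ?_
    rw [past_eq_comap_initial]
    exact ⟨_, measurableSet_singleton z, rfl⟩
  · have : Measurable[⨆ k ∈ {k | ¬ k < n},
        MeasurableSpace.comap (fun ω : Path d => ω k) inferInstance] (glue z) := by
      refine @measurable_pi_lambda _ _ _ (_) _ _ fun k => ?_
      unfold glue
      by_cases hk : k < n
      · simp only [hk, dif_pos]
        exact @measurable_const _ _ _ (_) _
      · simp only [hk, dif_neg, not_false_iff]
        refine Measurable.of_comap_le ?_
        exact le_iSup₂ (f := fun (k : ℕ) (_ : k ∈ {k | ¬ k < n}) =>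
          MeasurableSpace.comap (fun ω : Path d => ω k) inferInstance) k hk
    exact this hT

theorem restrict_initial_eq (hP : iIndepFun (fun (n : ℕ) (ω : Path d) => ω n) P)
    (z : Fin n → Fin (d + 1)) :
    P.restrict (initial d n ⁻¹' {z}) = P (initial d n ⁻¹' {z}) • P.map (glue z) := by
  ext T hT
  rw [Measure.restrict_apply hT, Measure.smul_apply, Measure.map_apply (measurable_glue z) hT,
    Set.inter_comm, measure_inter_preimage_glue hP z hT, smul_eq_mul]

theorem measure_initial_preimage (hP : iIndepFun (fun (n : ℕ) (ω : Path d) => ω n) P)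
    (z : Fin n → Fin (d + 1)) :
    P (initial d n ⁻¹' {z}) = ∏ k : Fin n, P {ω | ω k = z k} := by
  have h := (hP.precomp (g := fun k : Fin n => (k : ℕ)) Fin.val_injective
    ).measure_inter_preimage_eq_mul Finset.univ (sets := fun k => {z k})
      (fun k _ => measurableSet_singleton _)
  have e : initial d n ⁻¹' {z} = ⋂ k ∈ (Finset.univ : Finset (Fin n)),
      (fun ω : Path d => ω (k : ℕ)) ⁻¹' {z k} := by
    ext ω
    simp [initial, funext_iff]
  rw [e, h]
  rfl

theorem integral_comp_initial [IsProbabilityMeasure P]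
    (hP : iIndepFun (fun (n : ℕ) (ω : Path d) => ω n) P) (φ : (Fin n → Fin (d + 1)) → ℝ) :
    ∫ ω, φ (initial d n ω) ∂P = cubeMean (fun (k : Fin n) i => P.real {ω | ω k = i}) φ := by
  have : IsProbabilityMeasure (P.map (initial d n)) :=
    Measure.isProbabilityMeasure_map (measurable_initial d n).aemeasurable
  rw [← integral_map (measurable_initial d n).aemeasurable
    (measurable_of_finite φ).aestronglyMeasurable, integral_fintype .of_finite]
  refine Finset.sum_congr rfl fun z _ => ?_
  rw [map_measureReal_apply (measurable_initial d n) (measurableSet_singleton z), smul_eq_mul,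
    Measure.real, measure_initial_preimage hP, ENNReal.toReal_prod]
  rfl

/-- Every finite start z has positive probability, so a null set stays null after conditioning on z.
Almost sure hypotheses on F thereby hold over every z, as the pointwise bounds on the cube require.
-/
theorem ae_glue (hP : iIndepFun (fun (n : ℕ) (ω : Path d) => ω n) P)
    (hpos : ∀ (n : ℕ) (i : Fin (d + 1)), 0 < P {ω | ω n = i}) {Q : Path d → Prop}
    (hQ : ∀ᵐ ω ∂P, Q ω) (z : Fin n → Fin (d + 1)) : ∀ᵐ ω ∂P, Q (glue z ω) := by
  refine ae_of_ae_map (measurable_glue z).aemeasurable ?_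
  have h0 : P (initial d n ⁻¹' {z}) ≠ 0 := by
    rw [measure_initial_preimage hP]
    exact Finset.prod_ne_zero_iff.2 fun k _ => (hpos _ _).ne'
  have h1 : ∀ᵐ ω ∂(P (initial d n ⁻¹' {z}) • P.map (glue z)), Q ω := by
    rw [← restrict_initial_eq hP z]
    exact ae_restrict_of_ae hQ
  rwa [Measure.ae_ennreal_smul_measure_iff h0] at h1

/-- The conditional expectation of `F` given the first `n` coordinates, as a function of them. -/
noncomputable def partialMean (P : Measure (Path d)) (F : Path d → ℝ) (n : ℕ)
    (z : Fin n → Fin (d + 1)) : ℝ :=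
  ∫ ω, F (glue z ω) ∂P

theorem setIntegral_initial (hP : iIndepFun (fun (n : ℕ) (ω : Path d) => ω n) P)
    {F : Path d → ℝ} (hF : Measurable F) (z : Fin n → Fin (d + 1)) :
    ∫ ω in initial d n ⁻¹' {z}, F ω ∂P =
      P.real (initial d n ⁻¹' {z}) * partialMean P F n z := by
  rw [restrict_initial_eq hP, integral_smul_measure,
    integral_map (measurable_glue z).aemeasurable hF.aestronglyMeasurable]
  rfl

theorem condExp_past_eq [IsProbabilityMeasure P]
    (hP : iIndepFun (fun (n : ℕ) (ω : Path d) => ω n) P) {F : Path d → ℝ} (hF : Measurable F)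
    (hint : Integrable F P) (n : ℕ) :
    P[F | past d n] =ᵐ[P] fun ω => partialMean P F n (initial d n ω) := by
  have hfin : Integrable (fun ω => partialMean P F n (initial d n ω)) P :=
    (Integrable.of_finite (μ := P.map (initial d n)) (f := partialMean P F n)).comp_measurable
      (measurable_initial d n)
  refine (ae_eq_condExp_of_forall_setIntegral_eq (past_le d n) hint
    (fun s _ _ => hfin.integrableOn) ?_ ?_).symm
  · intro s hs _
    rw [past_eq_comap_initial] at hs
    obtain ⟨B, hB, rfl⟩ := hs
    have e : initial d n ⁻¹' B =
        ⋃ z ∈ B.toFinite.toFinset, initial d n ⁻¹' {z} := by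
      ext ω
      simp
    have hm : ∀ z ∈ B.toFinite.toFinset, MeasurableSet (initial d n ⁻¹' {z}) := fun z _ =>
      measurable_initial d n (measurableSet_singleton z)
    have hd : Set.Pairwise (B.toFinite.toFinset : Set (Fin n → Fin (d + 1)))
        (Function.onFun Disjoint fun z => initial d n ⁻¹' {z}) := fun z _ z' _ hz =>
      Disjoint.preimage _ (Set.disjoint_singleton.2 hz)
    rw [e, integral_biUnion_finset _ hm hd fun z _ => hfin.integrableOn,
      integral_biUnion_finset _ hm hd fun z _ => hint.integrableOn]
    refine Finset.sum_congr rfl fun z hz => ?_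
    rw [setIntegral_initial hP hF, setIntegral_congr_fun (hm z hz)
      (g := fun _ => partialMean P F n z) fun ω hω => by
        simp only [Set.mem_preimage, Set.mem_singleton_iff] at hω
        simp only [hω], setIntegral_const, smul_eq_mul]
  · refine (Measurable.stronglyMeasurable ?_).aestronglyMeasurable
    rw [past_eq_comap_initial]
    exact (measurable_of_finite (partialMean P F n)).comp (comap_measurable (initial d n))

/-- The filtration of the strict pasts. -/
def pastFiltration (d : ℕ) : Filtration ℕ (inferInstance : MeasurableSpace (Path d)) where
  seq := past d
  mono' := fun _ m hnm => iSup_le fun k =>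
    le_iSup (fun l : Fin m => MeasurableSpace.comap (fun ω : Path d => ω l) inferInstance)
      (Fin.castLE hnm k)
  le' := past_le d

theorem iSup_pastFiltration (d : ℕ) :
    ⨆ n, pastFiltration d n = (inferInstance : MeasurableSpace (Path d)) := by
  refine le_antisymm (iSup_le fun n => past_le d n) ?_
  refine iSup_le fun k => le_trans ?_ (le_iSup (fun n => pastFiltration d n) (k + 1))
  exact le_iSup (fun l : Fin (k + 1) => MeasurableSpace.comap (fun ω : Path d => ω l)
    inferInstance) (Fin.last k)

/-- Lévy's upward theorem: the pasts generate the whole σ-algebra, so the limit of the conditional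
expectations is F itself. -/
theorem tendsto_partialMean [IsProbabilityMeasure P]
    (hP : iIndepFun (fun (n : ℕ) (ω : Path d) => ω n) P) {F : Path d → ℝ} (hF : Measurable F)
    (hint : Integrable F P) :
    ∀ᵐ ω ∂P, Filter.Tendsto (fun n => partialMean P F n (initial d n ω)) Filter.atTop
      (nhds (F ω)) := by
  have h := tendsto_ae_condExp (μ := P) (ℱ := pastFiltration d) F
  rw [iSup_pastFiltration, condExp_of_stronglyMeasurable le_rfl hF.stronglyMeasurable hint] at h
  filter_upwards [h, ae_all_iff.2 fun n => condExp_past_eq hP hF hint n] with ω h1 h2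
  exact h1.congr h2

end Glue

/-! ### Deviation inequality for functionals of the walk -/

section Deviation

variable {d : ℕ} {P : Measure (Path d)} [IsProbabilityMeasure P]

theorem integral_comp_apply (n : ℕ) (φ : Fin (d + 1) → ℝ) :
    ∫ ω, φ (ω n) ∂P = ∑ i, P.real {ω | ω n = i} * φ i := by
  have hm : Measurable fun ω : Path d => ω n := measurable_pi_apply n
  have : IsProbabilityMeasure (P.map fun ω : Path d => ω n) :=
    Measure.isProbabilityMeasure_map hm.aemeasurable
  rw [← integral_map hm.aemeasurable (measurable_of_finite φ).aestronglyMeasurable,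
    integral_fintype .of_finite]
  refine Finset.sum_congr rfl fun i _ => ?_
  rw [map_measureReal_apply hm (measurableSet_singleton i), smul_eq_mul]
  rfl

theorem sum_measureReal_apply_eq (n : ℕ) : ∑ i, P.real {ω : Path d | ω n = i} = 1 := by
  simpa using (integral_comp_apply (P := P) n fun _ => 1).symm

/-- Taking expectations of the conditional moments leaves the plain moment relations of the law of
X_n. -/
theorem IsObtuseRandomWalk.inner_coeff {v : ℕ → Fin (d + 1) → EuclideanSpace ℝ (Fin d)}
    (hY : IsObtuseRandomWalk P v) (n : ℕ) (a b : Fin (d + 1)) :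
    inner ℝ (coeff P v n a) (coeff P v n b) =
      covKernel (fun i => P.real {ω | ω n = i}) (a, b) := by
  refine inner_smul_smul_eq_covKernel (sum_measureReal_apply_eq n) (fun j => ?_)
    (fun j j' => ?_) a b
  · rw [← integral_comp_apply n fun i => v n i j]
    have := integral_condExp (past_le d n) (f := fun ω => increment v n ω j) (μ := P)
    rw [integral_congr_ae (hY.condExp_increment n j)] at this
    simpa [increment] using this.symm
  · rw [← integral_comp_apply n fun i => v n i j * v n i j']
    have := integral_condExp (past_le d n)
      (f := fun ω => increment v n ω j * increment v n ω j') (μ := P)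
    rw [integral_congr_ae (hY.condExp_increment_mul n j j')] at this
    simpa [increment] using this.symm

-- There are d + 1 vectors of squared norm at most dC², and (d + 1)d ≤ 2d². This is where the factor
-- dC of the theorem arises.
omit [IsProbabilityMeasure P] in
theorem sum_norm_sq_coeff_le {v : ℕ → Fin (d + 1) → EuclideanSpace ℝ (Fin d)} {C : ℝ} {k : ℕ}
    (hC : ∀ (i : Fin (d + 1)) (j : Fin d), |coeff P v k i j| ≤ C) :
    ∑ i, ‖coeff P v k i‖ ^ 2 ≤ 2 * (d * C) ^ 2 := by
  have h1 : ∀ i, ‖coeff P v k i‖ ^ 2 ≤ d * C ^ 2 := by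
    intro i
    rw [EuclideanSpace.norm_sq_eq]
    refine (Finset.sum_le_sum fun j _ => (?_ : _ ≤ C ^ 2)).trans_eq (by simp)
    rw [Real.norm_eq_abs]
    exact pow_le_pow_left₀ (abs_nonneg _) (hC i j) 2
  refine (Finset.sum_le_sum fun i _ => h1 i).trans ?_
  have h2 : (d : ℝ) ≤ (d : ℝ) ^ 2 := by exact_mod_cast Nat.le_self_pow two_ne_zero d
  have h3 := mul_le_mul_of_nonneg_right h2 (sq_nonneg C)
  simp only [Finset.sum_const, Finset.card_univ, Fintype.card_fin, nsmul_eq_mul, Nat.cast_add,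
    Nat.cast_one]
  linarith

theorem integrable_comp_glue (hP : iIndepFun (fun (n : ℕ) (ω : Path d) => ω n) P)
    (hpos : ∀ (n : ℕ) (i : Fin (d + 1)), 0 < P {ω | ω n = i}) {F : Path d → ℝ}
    (hF : Measurable F) {M : ℝ} (hM : ∀ᵐ ω ∂P, |F ω| ≤ M) {n : ℕ} (z : Fin n → Fin (d + 1)) :
    Integrable (fun ω => F (glue z ω)) P :=
  Integrable.of_bound (hF.comp (measurable_glue z)).aestronglyMeasurable M
    (ae_glue hP hpos hM z)

theorem abs_partialMean_le (hP : iIndepFun (fun (n : ℕ) (ω : Path d) => ω n) P)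
    (hpos : ∀ (n : ℕ) (i : Fin (d + 1)), 0 < P {ω | ω n = i}) {F : Path d → ℝ}
    {M : ℝ} (hM : ∀ᵐ ω ∂P, |F ω| ≤ M) {n : ℕ} (z : Fin n → Fin (d + 1)) :
    |partialMean P F n z| ≤ M := by
  have h : ∀ᵐ ω ∂P, ‖F (glue z ω)‖ ≤ M := ae_glue hP hpos hM z
  simpa [partialMean] using norm_integral_le_of_norm_le_const h

theorem abs_partialMean_update_sub_le (hP : iIndepFun (fun (n : ℕ) (ω : Path d) => ω n) P)
    (hpos : ∀ (n : ℕ) (i : Fin (d + 1)), 0 < P {ω | ω n = i}) {F : Path d → ℝ}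
    (hF : Measurable F) {M : ℝ} (hM : ∀ᵐ ω ∂P, |F ω| ≤ M) {K : ℝ}
    (hFK : ∀ᵐ ω ∂P, ∀ (k : ℕ) (i i' : Fin (d + 1)),
      |F (Function.update ω k i) - F (Function.update ω k i')| ≤ K)
    {n : ℕ} (z : Fin n → Fin (d + 1)) (k : Fin n) (i i' : Fin (d + 1)) :
    |partialMean P F n (Function.update z k i) - partialMean P F n (Function.update z k i')| ≤
      K := by
  unfold partialMean
  rw [← integral_sub (integrable_comp_glue hP hpos hF hM _)
    (integrable_comp_glue hP hpos hF hM _)]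
  have h : ∀ᵐ ω ∂P, ‖F (glue (Function.update z k i) ω) -
      F (glue (Function.update z k i') ω)‖ ≤ K := by
    filter_upwards [ae_glue hP hpos hFK z] with ω hω
    rw [glue_update, glue_update]
    exact hω k i i'
  simpa using norm_integral_le_of_norm_le_const h

/-- For k < n the gradient commutes with averaging over the later coordinates, so the norm of the
averaged gradient is at most the average of the norms. The sum over k < n under the integral is at
most the full series, hence at most N. -/
theorem sum_norm_gradient_partialMean_le
    (hP : iIndepFun (fun (n : ℕ) (ω : Path d) => ω n) P)
    (hpos : ∀ (n : ℕ) (i : Fin (d + 1)), 0 < P {ω | ω n = i})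
    (v : ℕ → Fin (d + 1) → EuclideanSpace ℝ (Fin d)) {F : Path d → ℝ}
    (hF : Measurable F) {M : ℝ} (hM : ∀ᵐ ω ∂P, |F ω| ≤ M) {N : ℝ} (hN0 : 0 ≤ N)
    (hN : gradientNorm P v F ≤ ENNReal.ofReal N) {n : ℕ} (z : Fin n → Fin (d + 1)) :
    ∑ k : Fin n, ‖∑ i, partialMean P F n (Function.update z k i) • coeff P v k i‖ ≤ N := by
  have hg : ∀ᵐ ω ∂P, ∑' k : ℕ, ‖gradient P v F k ω‖ₑ ≤ ENNReal.ofReal N := by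
    filter_upwards [ENNReal.ae_le_essSup fun ω => ∑' k : ℕ, ‖gradient P v F k ω‖ₑ] with ω hω
    exact hω.trans hN
  have hint : ∀ k : Fin n, Integrable (fun ω => gradient P v F k (glue z ω)) P := by
    intro k
    unfold gradient
    refine integrable_finsetSum _ fun i _ => Integrable.smul_const ?_ _
    simp only [← glue_update]
    exact integrable_comp_glue hP hpos hF hM _
  have e : ∀ k : Fin n, ∑ i, partialMean P F n (Function.update z k i) • coeff P v k i =
      ∫ ω, gradient P v F k (glue z ω) ∂P := by
    intro k
    unfold gradient partialMean
    simp only [← glue_update]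
    rw [integral_finsetSum _ fun i _ =>
      (integrable_comp_glue hP hpos hF hM _).smul_const _]
    exact Finset.sum_congr rfl fun i _ => (integral_smul_const _ _).symm
  simp only [e]
  calc _ ≤ ∑ k : Fin n, ∫ ω, ‖gradient P v F k (glue z ω)‖ ∂P :=
        Finset.sum_le_sum fun k _ => norm_integral_le_integral_norm _
    _ = ∫ ω, ∑ k : Fin n, ‖gradient P v F k (glue z ω)‖ ∂P :=
        (integral_finsetSum _ fun k _ => (hint k).norm).symm
    _ ≤ ∫ _, N ∂P := by
        refine integral_mono_ae (integrable_finsetSum _ fun k _ => (hint k).norm)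
          (integrable_const N) ?_
        filter_upwards [ae_glue hP hpos hg z] with ω hω
        refine (ENNReal.ofReal_le_ofReal_iff hN0).1 (le_trans ?_ hω)
        rw [ENNReal.ofReal_sum_of_nonneg fun k _ => norm_nonneg _]
        simp only [ofReal_norm]
        rw [Fin.sum_univ_eq_sum_range fun k => ‖gradient P v F k (glue z ω)‖ₑ]
        exact ENNReal.sum_le_tsum _
    _ = N := by simp

theorem IsObtuseRandomWalk.mgf_sub_integral_le
    {v : ℕ → Fin (d + 1) → EuclideanSpace ℝ (Fin d)} (hY : IsObtuseRandomWalk P v)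
    {F : Path d → ℝ} (hF : Measurable F) {M : ℝ} (hM : ∀ᵐ ω ∂P, |F ω| ≤ M) {K C : ℝ}
    (hK : 0 < K) (hC : 0 ≤ C)
    (hFK : ∀ᵐ ω ∂P, ∀ (k : ℕ) (i i' : Fin (d + 1)),
      |F (Function.update ω k i) - F (Function.update ω k i')| ≤ K)
    (hcC : ∀ (k : ℕ) (i : Fin (d + 1)) (j : Fin d), |coeff P v k i j| ≤ C) {N : ℝ}
    (hN0 : 0 ≤ N) (hN : gradientNorm P v F ≤ ENNReal.ofReal N) {s : ℝ} (hs : 0 ≤ s) :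
    mgf (fun ω => F ω - ∫ ω', F ω' ∂P) P s ≤
      Real.exp (d * C * N * ((Real.exp (s * K) - 1) / K - s)) := by
  have hP := hY.indep
  have hint : Integrable F P := Integrable.of_bound hF.aestronglyMeasurable M hM
  have hmean : ∀ n, cubeMean (fun (k : Fin n) i => P.real {ω | ω k = i}) (partialMean P F n) =
      ∫ ω, F ω ∂P := by
    intro n
    rw [← integral_comp_initial hP, ← integral_congr_ae (condExp_past_eq hP hF hint n),
      integral_condExp (past_le d n)]
  have hn : ∀ n, ∫ ω, Real.exp (s * (partialMean P F n (initial d n ω) - ∫ ω', F ω' ∂P)) ∂P ≤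
      Real.exp (d * C * N * ((Real.exp (s * K) - 1) / K - s)) := by
    intro n
    rw [integral_comp_initial hP
      (fun z => Real.exp (s * (partialMean P F n z - ∫ ω', F ω' ∂P))), ← hmean n]
    exact cubeMean_exp_le (p := fun (k : Fin n) i => P.real {ω | ω k = i})
      (c := fun (k : Fin n) i => coeff P v k i) (fun k i => measureReal_nonneg)
      (fun k => sum_measureReal_apply_eq (k : ℕ)) (fun k => hY.inner_coeff k)
      (D := d * C) (by positivity) (fun k => sum_norm_sq_coeff_le (hcC k))
      (partialMean P F n) hK
      (sum_norm_gradient_partialMean_le hP hY.pos v hF hM hN0 hN)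
      (abs_partialMean_update_sub_le hP hY.pos hF hM hFK) hs
  -- The conditional means inherit the bound M, so a constant dominates and the estimate, uniform in
  -- n, survives the limit.
  refine le_of_tendsto (tendsto_integral_of_dominated_convergence
    (fun _ => Real.exp (s * (M - ∫ ω', F ω' ∂P))) (fun n => ?_) (integrable_const _)
    (fun n => Filter.Eventually.of_forall fun ω => ?_) ?_) (Filter.Eventually.of_forall hn)
  · exact ((measurable_of_finite fun z : Fin n → Fin (d + 1) =>
      Real.exp (s * (partialMean P F n z - ∫ ω', F ω' ∂P))).comp
      (measurable_initial d n)).aestronglyMeasurable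
  · rw [Real.norm_of_nonneg (Real.exp_pos _).le]
    exact Real.exp_le_exp.2 (mul_le_mul_of_nonneg_left (sub_le_sub_right
      (le_of_abs_le (abs_partialMean_le hP hY.pos hM _)) _) hs)
  · filter_upwards [tendsto_partialMean hP hF hint] with ω hω
    exact (Real.continuous_exp.tendsto _).comp ((hω.sub_const _).const_mul s)

theorem IsObtuseRandomWalk.measureReal_ge_le
    {v : ℕ → Fin (d + 1) → EuclideanSpace ℝ (Fin d)} (hY : IsObtuseRandomWalk P v)
    {F : Path d → ℝ} (hF : Measurable F) {M : ℝ} (hM : ∀ᵐ ω ∂P, |F ω| ≤ M) {K C : ℝ}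
    (hK : 0 < K) (hC : 0 ≤ C)
    (hFK : ∀ᵐ ω ∂P, ∀ (k : ℕ) (i i' : Fin (d + 1)),
      |F (Function.update ω k i) - F (Function.update ω k i')| ≤ K)
    (hcC : ∀ (k : ℕ) (i : Fin (d + 1)) (j : Fin d), |coeff P v k i j| ≤ C) {N : ℝ}
    (hN0 : 0 ≤ N) (hN : gradientNorm P v F ≤ ENNReal.ofReal N) {s : ℝ} (hs : 0 ≤ s) (x : ℝ) :
    P.real {ω | x ≤ F ω - ∫ ω', F ω' ∂P} ≤
      Real.exp (-s * x + d * C * N * ((Real.exp (s * K) - 1) / K - s)) := by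
  have hexp : Integrable (fun ω => Real.exp (s * (F ω - ∫ ω', F ω' ∂P))) P := by
    refine Integrable.of_bound (by fun_prop) (Real.exp (s * (M - ∫ ω', F ω' ∂P))) ?_
    filter_upwards [hM] with ω hω
    rw [Real.norm_of_nonneg (Real.exp_pos _).le]
    exact Real.exp_le_exp.2 (mul_le_mul_of_nonneg_left (sub_le_sub_right
      (le_of_abs_le hω) _) hs)
  rw [Real.exp_add]
  exact (measure_ge_le_exp_mul_mgf x hs hexp).trans (mul_le_mul_of_nonneg_left
    (hY.mgf_sub_integral_le hF hM hK hC hFK hcC hN0 hN hs) (Real.exp_pos _).le)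

/-- The difference of the two sides is (1 + u/2) ln(1 + u) − u, so the claim is ln(1 + u) ≥ 2u/(u +
2). -/
theorem half_mul_log_le_rate {u : ℝ} (hu : 0 ≤ u) : u / 2 * Real.log (1 + u) ≤ rate u := by
  have h := Real.le_log_one_add_of_nonneg hu
  rw [div_le_iff₀ (by linarith)] at h
  unfold rate
  linarith

end Deviation

end ObtuseWalk
theorem mainTheorem2 (d : ℕ)
    (P : MeasureTheory.Measure (ObtuseWalk.Path d)) [MeasureTheory.IsProbabilityMeasure P]
    (v : ℕ → Fin (d + 1) → EuclideanSpace ℝ (Fin d))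
    (hY : ObtuseWalk.IsObtuseRandomWalk P v)
    (F : ObtuseWalk.Path d → ℝ) (hF : Measurable F)
    (hbdd : ∃ M : ℝ, ∀ᵐ ω ∂P, |F ω| ≤ M)
    (K C : ℝ) (hK : 0 < K) (hC : 0 < C)
    (hFK : ∀ᵐ ω ∂P, ∀ (k : ℕ) (i i' : Fin (d + 1)),
      |F (Function.update ω k i) - F (Function.update ω k i')| ≤ K)
    (hcC : ∀ (k : ℕ) (i : Fin (d + 1)) (j : Fin d), |ObtuseWalk.coeff P v k i j| ≤ C)
    (N : ℝ) (hN : ObtuseWalk.gradientNorm P v F = ENNReal.ofReal N) (hN0 : 0 ≤ N)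
    (x : ℝ) (hx : 0 ≤ x) :
    (0 < N →
      P.real {ω | x ≤ F ω - ∫ ω', F ω' ∂P} ≤
          Real.exp (-(d * C * N / K) * ObtuseWalk.rate (x / (d * C * N))) ∧
        Real.exp (-(d * C * N / K) * ObtuseWalk.rate (x / (d * C * N))) ≤
          Real.exp (-(x / (2 * K)) * Real.log (1 + x / (d * C * N)))) ∧
    (N = 0 → 0 < x → P.real {ω | x ≤ F ω - ∫ ω', F ω' ∂P} = 0) := by
  obtain ⟨M, hM⟩ := hbdd
  have tail := fun (s : ℝ) (hs : 0 ≤ s) =>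
    hY.measureReal_ge_le hF hM hK hC.le hFK hcC hN0 hN.le hs x
  refine ⟨fun _ => ?_, fun hN' hx' => ?_⟩
  · have hD0 : 0 ≤ d * C * N := by positivity
    -- With N > 0 a vanishing product means d = 0. Division by zero then makes both bounds equal to
    -- 1.
    rcases hD0.eq_or_lt with hD | hD
    · rw [← hD]
      simp [measureReal_le_one]
    · set D := d * C * N with hDdef
      have hu : 0 ≤ x / D := div_nonneg hx hD0
      have hu1 : 0 < 1 + x / D := by linarith
      have hxD : x = D * (x / D) := by field_simp
      constructor
      -- This s minimizes the Chernoff exponent: its derivative −x + D(e^{sK} − 1) vanishes when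
      -- e^{sK} = 1 + x/D.
      · refine (tail (Real.log (1 + x / D) / K)
          (div_nonneg (Real.log_nonneg (by linarith)) hK.le)).trans (le_of_eq ?_)
        rw [div_mul_cancel₀ _ hK.ne', Real.exp_log hu1, ObtuseWalk.rate]
        congr 1
        field_simp
        ring
      · refine Real.exp_le_exp.2 ?_
        have h := mul_le_mul_of_nonneg_left (ObtuseWalk.half_mul_log_le_rate hu)
          (div_nonneg hD0 hK.le)
        have e : D / K * (x / D / 2 * Real.log (1 + x / D)) =
            x / (2 * K) * Real.log (1 + x / D) := by
          field_simp
        rw [e] at h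
        linarith
  · subst hN'
    refine le_antisymm ?_ MeasureTheory.measureReal_nonneg
    -- With N = 0 the Chernoff bound is e^{−sx} for every s ≥ 0, and s may tend to infinity.
    have hlim : Filter.Tendsto (fun s : ℝ => Real.exp (-s * x)) Filter.atTop (nhds 0) :=
      Real.tendsto_exp_atBot.comp
        (Filter.Tendsto.atBot_mul_const hx' Filter.tendsto_neg_atTop_atBot)
    refine ge_of_tendsto hlim ((Filter.eventually_ge_atTop 0).mono fun s hs => ?_)
    simpa using tail s hs
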